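/- Let $\Lambda$ be an Artin algebra (an algebra, finitely generated as a module, over a commutative artinian ring), let $\mathrm{mod}\,\Lambda$ be the category of finitely generated left $\Lambda$-modules, and let $\mathcal P$ be the class of projectives in it. For $M\in\mathrm{mod}\,\Lambda$ let $\Omega M$ be the kernel of a projective cover of $M$. All dimensions below take values in $\mathbb N\cup\{\infty\}$, with $\min\emptyset=\infty$ and $\sup\emptyset=0$. **Definitions.** The projective dimension $\mathrm{pd}\,M$ (injective dimension $\mathrm{id}\,M$) is the least $n\in\mathbb N$ with $\mathrm{Ext}^j_\Lambda(M,-)=0$ (resp. $\mathrm{Ext}^j_\Lambda(-,M)=0$) on $\mathrm{mod}\,\Lambda$ for all $j>n$. For classes $\omega,\mathcal Z\subseteq\mathrm{mod}\,\Lambda$ put $\mathrm{id}(\omega)=\sup\{\mathrm{id}\,W: W\in\omega\}$ and $\mathrm{fin.dim}(\mathcal Z)=\sup\{\mathrm{pd}\,Z: Z\in\mathcal Z,\ \mathrm{pd}\,Z<\infty\}$, and $\mathrm{fin.dim}\,\Lambda=\mathrm{fin.dim}(\mathrm{mod}\,\Lambda)$. Let $K$ be the abelian group generated by the symbols $[M]$,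 $M\in\mathrm{mod}\,\Lambda$, with relations $[M]=[X]+[Y]$ whenever $M\cong X\oplus Y$, and let $L:K\to K$ be the endomorphism $[M]\mapsto[\Omega M]$. For a class $\mathcal X$, let $\langle\mathcal X\rangle\le K$ be generated by the $[M]$ with $M$ indecomposable and $M\in\mathcal X\cup\mathcal P$. Let $\overline L$ be the endomorphism of $K/\langle\mathcal P\rangle$ induced by $L$. For $X\in\mathrm{mod}\,\Lambda$ let $\overline{\langle X\rangle}$ be the image of $\langle\mathrm{add}\,X\rangle$ in $K/\langle\mathcal P\rangle$, where $\mathrm{add}\,X$ consists of the direct summands of the modules $X^s$, $s\ge 0$. The Igusa–Todorov functions are $$\Phi(X)=\min\{k\in\mathbb N:\ \overline L:\overline L^{m}(\overline{\langle X\rangle})\to\overline L^{m+1}(\overline{\langle X\rangle})\text{ is an isomorphism for all }m\ge k\},$$ $$\Psi(X)=\Phi(X)+\mathrm{fin.dim}\{Z:\ Z\text{ is a direct summand of }\Omega^{\Phi(X)}X\}.$$ Put $\Phi\mathrm{dim}(\mathcal X)=\sup\{\Phi(X): X\in\mathcal X\}$, $\Phi\mathrm{dim}\,\Lambda=\Phi\mathrm{dim}(\mathrm{mod}\,\Lambda)$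 and $\Psi\mathrm{dim}\,\Lambda=\sup\{\Psi(X): X\in\mathrm{mod}\,\Lambda\}$. A class $\mathcal X$ is resolving if it contains $\mathcal P$ and is closed under extensions and kernels of epimorphisms between its objects; coresolving is the dual notion. A hereditary complete cotorsion pair in $\mathrm{mod}\,\Lambda$ is a pair $(\mathcal X,\mathcal Y)$ of classes such that - $\mathcal X=\{M:\mathrm{Ext}^1_\Lambda(M,Y)=0\ \forall\,Y\in\mathcal Y\}$ and $\mathcal Y=\{N:\mathrm{Ext}^1_\Lambda(X,N)=0\ \forall\,X\in\mathcal X\}$; - every $M\in\mathrm{mod}\,\Lambda$ admits exact sequences $0\to Y'\to X'\to M\to0$ and $0\to M\to Y\to X\to 0$ with $X,X'\in\mathcal X$ and $Y,Y'\in\mathcal Y$; - $\mathcal X$ is resolving and $\mathcal Y$ is coresolving. Finally, $\mathcal X^\wedge$ is the class of all $M\in\mathrm{mod}\,\Lambda$ admitting, for some $n\ge0$, an exact sequence $0\to X_n\to\cdots\to X_0\to M\to0$ with all $X_i\in\mathcal X$. **Statement.** Let $(\mathcal X,\mathcal Y)$ be a hereditary complete cotorsion pair in $\mathrm{mod}\,\Lambda$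 and let $n\ge0$ be an integer such that $\Omega^n M\in\mathcal X^\wedge$ for every $M\in\mathrm{mod}\,\Lambda$. Put $\omega=\mathcal X\cap\mathcal Y$. Then: (a) $\mathrm{fin.dim}\,\Lambda\le\Phi\mathrm{dim}\,\Lambda\le\mathrm{id}(\omega)+\Phi\mathrm{dim}(\mathcal X)+n$. (b) If $\Phi\mathrm{dim}(\mathcal X)=0$, then $\mathrm{fin.dim}\,\Lambda\le\Phi\mathrm{dim}\,\Lambda\le\Psi\mathrm{dim}\,\Lambda\le\mathrm{id}(\omega)+n$. -/

import Mathlib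

universe u

namespace IgusaTodorov

open CategoryTheory

/-! ### Artin algebras and finitely generated modules -/

/-- `Λ` is an Artin algebra: it is an algebra over some commutative artinian ring `k` and is
finitely generated as a `k`-module.  (One may always replace `k` by its image in `Λ`, so taking
`k` in the universe of `Λ` is no restriction.) -/
class IsArtinAlgebra (Λ : Type u) [Ring Λ] : Prop where
  exists_base : ∃ (k : Type u) (_ : CommRing k) (_ : IsArtinianRing k) (_ : Algebra k Λ),
    Module.Finite k Λ

instance IsArtinAlgebra.isArtinianRing (Λ : Type u) [Ring Λ] [h : IsArtinAlgebra Λ] :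
    IsArtinianRing Λ := by
  obtain ⟨k, _, _, _, _⟩ := h.exists_base
  exact IsArtinianRing.of_finite k Λ

section Artinian

variable {Λ : Type u} [Ring Λ]

/-- The class of all finitely generated projective modules. -/
def projectives (Λ : Type u) [Ring Λ] : Set (FGModuleCat.{u} Λ) :=
  {P | Module.Projective Λ P}

/-- The class of all finitely generated injective modules. -/
def injectives (Λ : Type u) [Ring Λ] : Set (FGModuleCat.{u} Λ) :=
  {I | Module.Injective Λ I}

/-- There is a short exact sequence `0 → A → B → C → 0`. -/
def ShortExactSeq (A B C : FGModuleCat.{u} Λ) : Prop :=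
  ∃ (f : A →ₗ[Λ] B) (g : B →ₗ[Λ] C),
    Function.Injective f ∧ Function.Exact f g ∧ Function.Surjective g

/-- `Ext^j_Λ(M, N) = 0`. -/
def ExtVanishes (j : ℕ) (M N : FGModuleCat.{u} Λ) : Prop :=
  Subsingleton (Abelian.Ext.{u} M.obj N.obj j)

/-- `M` is isomorphic to `X ⊕ Y`. -/
def IsSum (M X Y : FGModuleCat.{u} Λ) : Prop :=
  Nonempty (M ≃ₗ[Λ] X × Y)

/-- `Z` is (isomorphic to) a direct summand of `N`. -/
def IsSummand (Z N : FGModuleCat.{u} Λ) : Prop :=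
  ∃ Z' : FGModuleCat.{u} Λ, IsSum N Z Z'

/-- `add X`: the direct summands of finite direct sums of copies of `X`. -/
def addClosure (X : FGModuleCat.{u} Λ) : Set (FGModuleCat.{u} Λ) :=
  {Z | ∃ s : ℕ, IsSummand Z (FGModuleCat.of Λ (Fin s → X))}

/-! ### Homological dimensions -/

/-- The projective dimension: the least `n` with `Ext^j(M, -) = 0` on `mod Λ` for all `j > n`,
and `∞` if there is none. -/
noncomputable def projDim (M : FGModuleCat.{u} Λ) : ℕ∞ :=
  ⨅ (n : ℕ) (_ : ∀ j > n, ∀ N : FGModuleCat.{u} Λ, ExtVanishes j M N), (n : ℕ∞)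

/-- The injective dimension: the least `n` with `Ext^j(-, N) = 0` on `mod Λ` for all `j > n`,
and `∞` if there is none. -/
noncomputable def injDim (N : FGModuleCat.{u} Λ) : ℕ∞ :=
  ⨅ (n : ℕ) (_ : ∀ j > n, ∀ M : FGModuleCat.{u} Λ, ExtVanishes j M N), (n : ℕ∞)

/-- The injective dimension of a class of modules. -/
noncomputable def injDimClass (ω : Set (FGModuleCat.{u} Λ)) : ℕ∞ :=
  ⨆ W ∈ ω, injDim W

/-- The finitistic dimension of a class of modules: the supremum of the finite projective
dimensions of its members. -/
noncomputable def finDimClass (𝒵 : Set (FGModuleCat.{u} Λ)) : ℕ∞ :=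
  ⨆ Z ∈ 𝒵, ⨆ (_ : projDim Z < ⊤), projDim Z

/-- The finitistic dimension of the algebra. -/
noncomputable def finDim (Λ : Type u) [Ring Λ] : ℕ∞ :=
  finDimClass (Set.univ : Set (FGModuleCat.{u} Λ))

/-- `HasResolution 𝒳 n M`: there is an exact sequence `0 → Xₙ → ⋯ → X₁ → X₀ → M → 0` with all
`Xᵢ` in `𝒳`, given as a splice of short exact sequences. -/
def HasResolution (𝒳 : Set (FGModuleCat.{u} Λ)) : ℕ → FGModuleCat.{u} Λ → Prop
  | 0, M => ∃ X ∈ 𝒳, Nonempty (X ≃ₗ[Λ] M)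
  | n + 1, M => ∃ X ∈ 𝒳, ∃ K : FGModuleCat.{u} Λ, ShortExactSeq K X M ∧ HasResolution 𝒳 n K

/-- The class `𝒳^∧` of modules of finite `𝒳`-resolution dimension. -/
def finiteResolution (𝒳 : Set (FGModuleCat.{u} Λ)) : Set (FGModuleCat.{u} Λ) :=
  {M | ∃ n, HasResolution 𝒳 n M}

/-! ### Hereditary complete cotorsion pairs -/

/-- Resolving classes: closed under extensions and kernels of epimorphisms between members, and
containing the projectives. -/
structure IsResolving (𝒳 : Set (FGModuleCat.{u} Λ)) : Prop where
  extension : ∀ A B C : FGModuleCat.{u} Λ, ShortExactSeq A B C → A ∈ 𝒳 → C ∈ 𝒳 → B ∈ 𝒳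
  kernel : ∀ A B C : FGModuleCat.{u} Λ, ShortExactSeq A B C → B ∈ 𝒳 → C ∈ 𝒳 → A ∈ 𝒳
  projective : projectives Λ ⊆ 𝒳

/-- Coresolving classes: closed under extensions and cokernels of monomorphisms between members,
and containing the injectives. -/
structure IsCoresolving (𝒴 : Set (FGModuleCat.{u} Λ)) : Prop where
  extension : ∀ A B C : FGModuleCat.{u} Λ, ShortExactSeq A B C → A ∈ 𝒴 → C ∈ 𝒴 → B ∈ 𝒴
  cokernel : ∀ A B C : FGModuleCat.{u} Λ, ShortExactSeq A B C → A ∈ 𝒴 → B ∈ 𝒴 → C ∈ 𝒴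
  injective : injectives Λ ⊆ 𝒴

/-- `(𝒳, 𝒴)` is a cotorsion pair in `mod Λ`: `𝒳 = {}^{⊥₁}𝒴` and `𝒴 = 𝒳^{⊥₁}`. -/
structure IsCotorsionPair (𝒳 𝒴 : Set (FGModuleCat.{u} Λ)) : Prop where
  left_eq : 𝒳 = {M | ∀ Y ∈ 𝒴, ExtVanishes 1 M Y}
  right_eq : 𝒴 = {N | ∀ X ∈ 𝒳, ExtVanishes 1 X N}

/-- A hereditary complete cotorsion pair in `mod Λ`. -/
structure IsHereditaryCompleteCotorsionPair (𝒳 𝒴 : Set (FGModuleCat.{u} Λ)) : Prop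
    extends IsCotorsionPair 𝒳 𝒴 where
  complete_left : ∀ M : FGModuleCat.{u} Λ, ∃ Y' ∈ 𝒴, ∃ X' ∈ 𝒳, ShortExactSeq Y' X' M
  complete_right : ∀ M : FGModuleCat.{u} Λ, ∃ Y ∈ 𝒴, ∃ X ∈ 𝒳, ShortExactSeq M Y X
  resolving : IsResolving 𝒳
  coresolving : IsCoresolving 𝒴

/-! ### Projective covers and the syzygy -/

/-- `f : P → M` is a projective cover: `P` is projective, `f` is onto and its kernel is
superfluous. -/
structure IsProjectiveCover {P M : Type u} [AddCommGroup P] [Module Λ P] [AddCommGroup M]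
    [Module Λ M] (f : P →ₗ[Λ] M) : Prop where
  projective : Module.Projective Λ P
  surjective : Function.Surjective f
  superfluous : ∀ N : Submodule Λ P, N ⊔ LinearMap.ker f = ⊤ → N = ⊤

/-- Two projective covers of isomorphic modules have isomorphic kernels. -/
theorem IsProjectiveCover.nonempty_ker_equiv {P Q M N : Type u}
    [AddCommGroup P] [Module Λ P] [AddCommGroup Q] [Module Λ Q]
    [AddCommGroup M] [Module Λ M] [AddCommGroup N] [Module Λ N]
    [IsNoetherian Λ P] {f : P →ₗ[Λ] M} {g : Q →ₗ[Λ] N}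
    (hf : IsProjectiveCover f) (hg : IsProjectiveCover g) (e : M ≃ₗ[Λ] N) :
    Nonempty (LinearMap.ker f ≃ₗ[Λ] LinearMap.ker g) := by
  have := hf.projective
  have := hg.projective
  obtain ⟨a, ha⟩ := Module.projective_lifting_property g (e.toLinearMap ∘ₗ f) hg.surjective
  obtain ⟨b, hb⟩ := Module.projective_lifting_property f (e.symm.toLinearMap ∘ₗ g) hf.surjective
  have ha' : ∀ x, g (a x) = e (f x) := fun x => LinearMap.congr_fun ha x
  have hb' : ∀ x, f (b x) = e.symm (g x) := fun x => LinearMap.congr_fun hb x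
  have sa : Function.Surjective a := by
    rw [← LinearMap.range_eq_top]
    apply hg.superfluous
    rw [eq_top_iff]
    intro y _
    obtain ⟨x, hx⟩ := hf.surjective (e.symm (g y))
    have : y = a x + (y - a x) := by abel
    rw [this]
    refine Submodule.add_mem_sup ⟨x, rfl⟩ ?_
    simp [LinearMap.mem_ker, ha', hx]
  have sb : Function.Surjective b := by
    rw [← LinearMap.range_eq_top]
    apply hf.superfluous
    rw [eq_top_iff]
    intro y _
    obtain ⟨x, hx⟩ := hg.surjective (e (f y))
    have : y = b x + (y - b x) := by abel
    rw [this]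
    refine Submodule.add_mem_sup ⟨x, rfl⟩ ?_
    simp [LinearMap.mem_ker, hb', hx]
  have ia : Function.Injective a := by
    have : Function.Injective (b ∘ₗ a) :=
      IsNoetherian.injective_of_surjective_endomorphism (b ∘ₗ a) (sb.comp sa)
    exact Function.Injective.of_comp (f := b) this
  let E : P ≃ₗ[Λ] Q := LinearEquiv.ofBijective a ⟨ia, sa⟩
  have hE : (LinearMap.ker f).map E.toLinearMap = LinearMap.ker g := by
    ext y
    simp only [Submodule.mem_map, LinearMap.mem_ker]
    constructor
    · rintro ⟨x, hx, rfl⟩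
      change g (a x) = 0
      simp [ha', hx]
    · intro hy
      obtain ⟨x, rfl⟩ := sa y
      refine ⟨x, ?_, rfl⟩
      simpa [ha'] using hy
  exact ⟨(E.submoduleMap (LinearMap.ker f)).trans (LinearEquiv.ofEq _ _ hE)⟩

/-- The product of two projective covers is a projective cover. -/
theorem IsProjectiveCover.prodMap {P Q M N : Type u}
    [AddCommGroup P] [Module Λ P] [AddCommGroup Q] [Module Λ Q]
    [AddCommGroup M] [Module Λ M] [AddCommGroup N] [Module Λ N]
    {f : P →ₗ[Λ] M} {g : Q →ₗ[Λ] N}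
    (hf : IsProjectiveCover f) (hg : IsProjectiveCover g) :
    IsProjectiveCover (f.prodMap g) where
  projective := by
    have := hf.projective
    have := hg.projective
    infer_instance
  surjective := hf.surjective.prodMap hg.surjective
  superfluous := by
    intro N hN
    have key : ∀ x : P × Q, ∃ n ∈ N, f n.1 = f x.1 ∧ g n.2 = g x.2 := by
      intro x
      have hx : x ∈ N ⊔ LinearMap.ker (f.prodMap g) := hN ▸ Submodule.mem_top
      obtain ⟨n, hn, z, hz, rfl⟩ := Submodule.mem_sup.1 hx
      have hz' : f z.1 = 0 ∧ g z.2 = 0 := by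
        simpa [LinearMap.mem_ker, Prod.ext_iff] using hz
      exact ⟨n, hn, by simp [hz'.1], by simp [hz'.2]⟩
    have h2 : (N.comap (LinearMap.inr Λ P Q)) = ⊤ := by
      have hKer : (N ⊓ LinearMap.ker (g ∘ₗ LinearMap.snd Λ P Q)).map (LinearMap.fst Λ P Q) = ⊤ := by
        apply hf.superfluous
        rw [eq_top_iff]
        intro p _
        obtain ⟨n, hn, h1, h2⟩ := key (p, 0)
        have : p = n.1 + (p - n.1) := by abel
        rw [this]
        refine Submodule.add_mem_sup ⟨n, ⟨hn, ?_⟩, rfl⟩ ?_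
        · simpa [LinearMap.mem_ker] using h2
        · simp [LinearMap.mem_ker, h1]
      apply hg.superfluous
      rw [eq_top_iff]
      intro q _
      obtain ⟨n, hn, _, h2⟩ := key (0, q)
      have hm : n.1 ∈ (N ⊓ LinearMap.ker (g ∘ₗ LinearMap.snd Λ P Q)).map
          (LinearMap.fst Λ P Q) := hKer ▸ Submodule.mem_top
      obtain ⟨m, ⟨hmN, hmk⟩, hm1⟩ := hm
      have hmk' : g m.2 = 0 := by simpa [LinearMap.mem_ker] using hmk
      have hm1' : m.1 = n.1 := hm1
      have : q = (n.2 - m.2) + (q - (n.2 - m.2)) := by abel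
      rw [this]
      refine Submodule.add_mem_sup ?_ ?_
      · have : n - m ∈ N := N.sub_mem hn hmN
        have e : (LinearMap.inr Λ P Q) (n.2 - m.2) = n - m := by
          ext <;> simp [hm1']
        rw [Submodule.mem_comap, e]
        exact this
      · simp [LinearMap.mem_ker, h2, hmk']
    have h1 : N.comap (LinearMap.inl Λ P Q) = ⊤ := by
      apply hf.superfluous
      rw [eq_top_iff]
      intro p _
      obtain ⟨n, hn, h1, _⟩ := key (p, 0)
      have : p = n.1 + (p - n.1) := by abel
      rw [this]
      refine Submodule.add_mem_sup ?_ ?_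
      · have hq : n.2 ∈ N.comap (LinearMap.inr Λ P Q) := h2 ▸ Submodule.mem_top
        have := N.sub_mem hn hq
        have e : (LinearMap.inl Λ P Q) n.1 = n - (LinearMap.inr Λ P Q) n.2 := by
          ext <;> simp
        rw [Submodule.mem_comap, e]
        exact this
      · simp [LinearMap.mem_ker, h1]
    rw [eq_top_iff]
    rintro ⟨p, q⟩ _
    have hp : p ∈ N.comap (LinearMap.inl Λ P Q) := h1 ▸ Submodule.mem_top
    have hq : q ∈ N.comap (LinearMap.inr Λ P Q) := h2 ▸ Submodule.mem_top
    have := N.add_mem hp hq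
    simpa using this

variable [IsArtinianRing Λ]

/-- Over a left artinian ring every finitely generated module has a finitely generated projective
cover: take a projective of minimal length mapping onto it. -/
theorem exists_projectiveCover (M : FGModuleCat.{u} Λ) :
    ∃ (P : FGModuleCat.{u} Λ) (f : P →ₗ[Λ] M), IsProjectiveCover f := by
  classical
  let S : Set ℕ∞ := {l | ∃ (P : FGModuleCat.{u} Λ) (f : P →ₗ[Λ] M),
    Module.Projective Λ P ∧ Function.Surjective f ∧ Module.length Λ P = l}
  have hS : S.Nonempty := by
    obtain ⟨n, f, hf⟩ := Module.Finite.exists_fin' Λ M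
    exact ⟨_, FGModuleCat.of Λ (Fin n → Λ), f,
      (inferInstance : Module.Projective Λ (Fin n → Λ)), hf, rfl⟩
  obtain ⟨P, f, hP, hf, hl⟩ := csInf_mem hS
  refine ⟨P, f, hP, hf, ?_⟩
  intro N hN
  by_contra hne
  have hfN : Function.Surjective (f ∘ₗ N.subtype) := by
    intro m
    obtain ⟨p, rfl⟩ := hf m
    have hp : p ∈ N ⊔ LinearMap.ker f := hN ▸ Submodule.mem_top
    obtain ⟨n, hn, z, hz, rfl⟩ := Submodule.mem_sup.1 hp
    exact ⟨⟨n, hn⟩, by simp [LinearMap.mem_ker.1 hz]⟩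
  obtain ⟨g, hg⟩ := Module.projective_lifting_property (f ∘ₗ N.subtype) f hfN
  let e : Module.End Λ P := N.subtype ∘ₗ g
  have he : ∀ x, f (e x) = f x := fun x => LinearMap.congr_fun hg x
  have hen : ∀ (k : ℕ) x, f ((e ^ k) x) = f x := by
    intro k
    induction k with
    | zero => intro x; simp
    | succ k ih => intro x; rw [pow_succ', Module.End.mul_apply, he, ih]
  obtain ⟨k, hk, hk1⟩ := (e.eventually_isCompl_ker_pow_range_pow.and
    (Filter.eventually_ge_atTop 1)).exists
  let R : Submodule Λ P := LinearMap.range (e ^ k)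
  have hRN : R ≤ N := by
    rintro _ ⟨x, rfl⟩
    obtain ⟨j, rfl⟩ := Nat.exists_eq_add_of_le' hk1
    rw [pow_succ', Module.End.mul_apply]
    exact (g _).2
  have hRtop : R < ⊤ := lt_of_le_of_lt hRN (lt_top_iff_ne_top.2 hne)
  have hRproj : Module.Projective Λ R :=
    Module.Projective.of_split R.subtype (R.projectionOnto _ hk.symm)
      (by ext x; simp)
  have hmem : Module.length Λ R ∈ S := by
    refine ⟨FGModuleCat.of Λ R, f ∘ₗ R.subtype, hRproj, ?_, rfl⟩
    intro m
    obtain ⟨p, rfl⟩ := hf m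
    exact ⟨⟨(e ^ k) p, ⟨p, rfl⟩⟩, hen k p⟩
  have hlt : Module.length Λ R < Module.length Λ P := Submodule.length_lt hRtop.ne
  exact absurd (csInf_le (OrderBot.bddBelow S) hmem) (not_le.2 (hl ▸ hlt))

/-- A chosen projective cover `P → M`. -/
noncomputable def projectiveCover (M : FGModuleCat.{u} Λ) : FGModuleCat.{u} Λ :=
  (exists_projectiveCover M).choose

/-- The chosen projective cover map. -/
noncomputable def projectiveCoverMap (M : FGModuleCat.{u} Λ) : projectiveCover M →ₗ[Λ] M :=
  (exists_projectiveCover M).choose_spec.choose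

theorem isProjectiveCover_projectiveCoverMap (M : FGModuleCat.{u} Λ) :
    IsProjectiveCover (projectiveCoverMap M) :=
  (exists_projectiveCover M).choose_spec.choose_spec

/-- The syzygy `Ω M`: the kernel of the projective cover of `M`. -/
noncomputable def syzygy (M : FGModuleCat.{u} Λ) : FGModuleCat.{u} Λ :=
  FGModuleCat.of Λ (LinearMap.ker (projectiveCoverMap M))

theorem isSum_syzygy {M X Y : FGModuleCat.{u} Λ} (h : IsSum M X Y) :
    IsSum (syzygy M) (syzygy X) (syzygy Y) := by
  obtain ⟨e⟩ := h
  obtain ⟨E⟩ := (isProjectiveCover_projectiveCoverMap M).nonempty_ker_equiv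
    ((isProjectiveCover_projectiveCoverMap X).prodMap
      (isProjectiveCover_projectiveCoverMap Y)) e
  let A : LinearMap.ker ((projectiveCoverMap X).prodMap (projectiveCoverMap Y)) ≃ₗ[Λ]
      LinearMap.ker (projectiveCoverMap X) × LinearMap.ker (projectiveCoverMap Y) :=
    { toFun := fun z => (⟨z.1.1, (Prod.ext_iff.1 z.2).1⟩, ⟨z.1.2, (Prod.ext_iff.1 z.2).2⟩)
      map_add' := fun _ _ => rfl
      map_smul' := fun _ _ => rfl
      invFun := fun w => ⟨(w.1.1, w.2.1), Prod.ext w.1.2 w.2.2⟩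
      left_inv := fun _ => rfl
      right_inv := fun _ => rfl }
  exact ⟨E.trans A⟩

theorem subsingleton_syzygy {P : FGModuleCat.{u} Λ} (h : P ∈ projectives Λ) :
    Subsingleton (syzygy P) := by
  have hid : IsProjectiveCover (LinearMap.id : P →ₗ[Λ] P) :=
    ⟨h, Function.surjective_id, fun N hN => by simpa using hN⟩
  obtain ⟨E⟩ := (isProjectiveCover_projectiveCoverMap P).nonempty_ker_equiv hid
    (LinearEquiv.refl Λ P)
  have : Subsingleton (LinearMap.ker (LinearMap.id : P →ₗ[Λ] P)) := by
    rw [LinearMap.ker_id]; infer_instance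
  exact E.toEquiv.subsingleton

/-! ### The Igusa–Todorov functions -/

/-- The relations `[M] - [X] - [Y]` for `M ≅ X ⊕ Y`. -/
def splitRelations (Λ : Type u) [Ring Λ] : AddSubgroup (FreeAbelianGroup (FGModuleCat.{u} Λ)) :=
  AddSubgroup.closure {r | ∃ M X Y : FGModuleCat.{u} Λ, IsSum M X Y ∧
    r = FreeAbelianGroup.of M - FreeAbelianGroup.of X - FreeAbelianGroup.of Y}

/-- The group `K`: generated by the symbols `[M]`, `M` in `mod Λ`, modulo `[M] = [X] + [Y]`
whenever `M ≅ X ⊕ Y`. -/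
abbrev K (Λ : Type u) [Ring Λ] : Type (u + 1) :=
  FreeAbelianGroup (FGModuleCat.{u} Λ) ⧸ splitRelations Λ

/-- The class `[M]` in `K`. -/
def K.mk (M : FGModuleCat.{u} Λ) : K Λ :=
  QuotientAddGroup.mk (FreeAbelianGroup.of M)

theorem K.mk_eq_zero {Λ : Type u} [Ring Λ] (M : FGModuleCat.{u} Λ) (h : Subsingleton M) :
    K.mk M = 0 := by
  have hM : IsSum M M M :=
    ⟨{ (0 : M →ₗ[Λ] M × M) with
        invFun := fun _ => 0
        left_inv := fun _ => Subsingleton.elim _ _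
        right_inv := fun _ => Subsingleton.elim _ _ }⟩
  rw [K.mk, QuotientAddGroup.eq_zero_iff]
  rw [← neg_mem_iff]
  exact AddSubgroup.subset_closure ⟨M, M, M, hM, by abel⟩

/-- The endomorphism `L : K → K`, `L [M] = [Ω M]`. -/
noncomputable def L (Λ : Type u) [Ring Λ] [IsArtinianRing Λ] : K Λ →+ K Λ :=
  QuotientAddGroup.map _ _ (FreeAbelianGroup.map syzygy) (by
    rw [splitRelations, AddSubgroup.closure_le]
    rintro _ ⟨M, X, Y, h, rfl⟩
    refine AddSubgroup.subset_closure ⟨_, _, _, isSum_syzygy h, ?_⟩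
    simp [FreeAbelianGroup.map_of_apply])

/-- The subgroup `⟨𝒳⟩` of `K` generated by the classes of the indecomposable modules which lie
in `𝒳` or are projective. -/
def bracket (𝒳 : Set (FGModuleCat.{u} Λ)) : AddSubgroup (K Λ) :=
  AddSubgroup.closure {x | ∃ M ∈ 𝒳 ∪ projectives Λ, Indecomposable M.obj ∧ x = K.mk M}

theorem L_mk (M : FGModuleCat.{u} Λ) : L Λ (K.mk M) = K.mk (syzygy M) := by
  simp [L, K.mk, FreeAbelianGroup.map_of_apply]

/-- The quotient `K_𝒫 = K / ⟨𝒫⟩`, with `𝒫` the class of projectives. -/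
abbrev KP (Λ : Type u) [Ring Λ] : Type (u + 1) :=
  K Λ ⧸ bracket (projectives Λ)

/-- The endomorphism of `K_𝒫` induced by `L`. -/
noncomputable def Lbar (Λ : Type u) [Ring Λ] [IsArtinianRing Λ] : KP Λ →+ KP Λ :=
  QuotientAddGroup.map _ _ (L Λ) (by
    rw [bracket, AddSubgroup.closure_le]
    rintro _ ⟨M, hM, -, rfl⟩
    have hM' : M ∈ projectives Λ := by simpa using hM
    change L Λ (K.mk M) ∈ bracket (projectives Λ)
    rw [L_mk, K.mk_eq_zero _ (subsingleton_syzygy hM')]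
    exact AddSubgroup.zero_mem _)

/-- `η_f(S)`: the least `k` such that `f` maps `f^m(S)` isomorphically onto `f^{m+1}(S)` for all
`m ≥ k` (a natural number whenever `S` is finitely generated; `∞` if there is no such `k`). -/
noncomputable def eta {G : Type*} [AddCommGroup G] (f : G →+ G) (S : AddSubgroup G) : ℕ∞ :=
  ⨅ (k : ℕ) (_ : ∀ m ≥ k, Set.BijOn f (f^[m] '' S) (f^[m + 1] '' S)), (k : ℕ∞)

/-- The first Igusa–Todorov function: `Φ(X) = η_{Lbar}` of the image of `⟨add X⟩` in `K_𝒫`.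
(That image is finitely generated, so `Φ(X)` is a natural number.) -/
noncomputable def Phi (X : FGModuleCat.{u} Λ) : ℕ∞ :=
  eta (Lbar Λ) ((bracket (addClosure X)).map (QuotientAddGroup.mk' (bracket (projectives Λ))))

/-- The second Igusa–Todorov function:
`Ψ(X) = Φ(X) + fin.dim {Z | Z is a direct summand of Ω^{Φ(X)}(X)}`. -/
noncomputable def Psi (X : FGModuleCat.{u} Λ) : ℕ∞ :=
  Phi X + finDimClass {Z | IsSummand Z (syzygy^[(Phi X).toNat] X)}

/-- The `Φ`-dimension of a class of modules. -/
noncomputable def PhiDimClass (𝒳 : Set (FGModuleCat.{u} Λ)) : ℕ∞ :=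
  ⨆ X ∈ 𝒳, Phi X

/-- The `Φ`-dimension of the algebra. -/
noncomputable def PhiDim (Λ : Type u) [Ring Λ] [IsArtinianRing Λ] : ℕ∞ :=
  PhiDimClass (Set.univ : Set (FGModuleCat.{u} Λ))

/-- The `Ψ`-dimension of the algebra. -/
noncomputable def PsiDim (Λ : Type u) [Ring Λ] [IsArtinianRing Λ] : ℕ∞ :=
  ⨆ X : FGModuleCat.{u} Λ, Psi X

end Artinian

end IgusaTodorov

namespace IgusaTodorov

open CategoryTheory Abelian

section

variable {Λ : Type u} [Ring Λ]

/-! ### Vanishing of `Ext` -/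

/-! Assume `id(ω) = d` is finite; otherwise the upper bounds are trivial. The heart is a descent
(`mem_of_syzygy_mem`): if `ΩN ∈ 𝒳` and `Ext¹(N, ω) = 0`, then `N ∈ 𝒳`. Indeed, in `0 → Y → X → N →
0` with `X ∈ 𝒳` and `Y ∈ 𝒴`, dimension shifting puts `Y` in `𝒳`, hence in `ω`, so the sequence
splits. A module in `𝒳^∧` has some syzygy in `𝒳`, and since `Ext` into `ω` vanishes above degree
`d`, the descent reaches the `d`-th syzygy. Hence `Ω^(d+n) M ∈ 𝒳` for every `M`.

The bound on `Φ` then follows from `Φ(M) ≤ Φ(ΩM) + 1`. The inequality `pd M ≤ Φ(M)` for finite `pd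
M` holds because the class of a module in `K_𝒫` is zero exactly when the module is projective. If
`Φ` vanishes on `𝒳`, it forces members of `𝒳` of finite projective dimension to be projective. A
summand `Z` of `Ω^k M`, `k = Φ(M) ≤ d + n`, with `pd Z` finite therefore has `pd Z ≤ d + n - k`,
which bounds `Ψ`. -/

/-- A short exact sequence of linear maps is a short exact complex in `ModuleCat Λ`. -/
theorem ShortExactSeq.exists_shortExact {A B C : FGModuleCat.{u} Λ} (f : A →ₗ[Λ] B)
    (g : B →ₗ[Λ] C) (hf : Function.Injective f) (hfg : Function.Exact f g)
    (hg : Function.Surjective g) :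
    ∃ w : ModuleCat.ofHom f ≫ ModuleCat.ofHom g = 0,
      (ShortComplex.mk (X₁ := A.obj) (X₂ := B.obj) (X₃ := C.obj)
        (ModuleCat.ofHom f) (ModuleCat.ofHom g) w).ShortExact := by
  refine ⟨?_, ?_⟩
  · ext x
    exact hfg.apply_apply_eq_zero x
  · exact ModuleCat.shortComplex_shortExact _ hfg hf hg

theorem ExtVanishes.of_retract {j : ℕ} {Z N Y : FGModuleCat.{u} Λ} (i : Z →ₗ[Λ] N)
    (p : N →ₗ[Λ] Z) (h : p ∘ₗ i = LinearMap.id) (hN : ExtVanishes j N Y) :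
    ExtVanishes j Z Y := by
  have : Subsingleton (Ext.{u} N.obj Y.obj j) := hN
  refine subsingleton_of_forall_eq 0 fun x => ?_
  have hid : (ModuleCat.ofHom i : Z.obj ⟶ N.obj) ≫ (ModuleCat.ofHom p : N.obj ⟶ Z.obj) = 𝟙 _ := by
    rw [← ModuleCat.ofHom_comp, h]; rfl
  have h0 : (Ext.mk₀ (ModuleCat.ofHom p : N.obj ⟶ Z.obj)).comp x (zero_add j) = 0 :=
    Subsingleton.elim _ _
  rw [← Ext.mk₀_id_comp x, ← hid, ← Ext.mk₀_comp_mk₀_assoc, h0, Ext.comp_zero]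

theorem ExtVanishes.right {j : ℕ} {A B C Y : FGModuleCat.{u} Λ} (h : ShortExactSeq A B C)
    (hA : ExtVanishes j A Y) (hB : ExtVanishes (j + 1) B Y) : ExtVanishes (j + 1) C Y := by
  obtain ⟨f, g, hf, hfg, hg⟩ := h
  obtain ⟨w, hS⟩ := ShortExactSeq.exists_shortExact f g hf hfg hg
  have : Subsingleton (Ext.{u} A.obj Y.obj j) := hA
  have : Subsingleton (Ext.{u} B.obj Y.obj (j + 1)) := hB
  refine subsingleton_of_forall_eq 0 fun x => ?_
  obtain ⟨y, hy⟩ := Ext.contravariant_sequence_exact₃ hS Y.obj x (Subsingleton.elim _ _)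
    (add_comm 1 j)
  rw [← hy, Subsingleton.elim y 0, Ext.comp_zero]

theorem ExtVanishes.left {j : ℕ} {A B C Y : FGModuleCat.{u} Λ} (h : ShortExactSeq A B C)
    (hB : ExtVanishes j B Y) (hC : ExtVanishes (j + 1) C Y) : ExtVanishes j A Y := by
  obtain ⟨f, g, hf, hfg, hg⟩ := h
  obtain ⟨w, hS⟩ := ShortExactSeq.exists_shortExact f g hf hfg hg
  have : Subsingleton (Ext.{u} B.obj Y.obj j) := hB
  have : Subsingleton (Ext.{u} C.obj Y.obj (j + 1)) := hC
  refine subsingleton_of_forall_eq 0 fun x => ?_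
  obtain ⟨y, hy⟩ := Ext.contravariant_sequence_exact₁ hS Y.obj x
    (add_comm 1 j) (Subsingleton.elim _ _)
  rw [← hy, Subsingleton.elim y 0, Ext.comp_zero]

theorem ExtVanishes.of_projective {P : FGModuleCat.{u} Λ} (hP : P ∈ projectives Λ) (j : ℕ)
    (Y : FGModuleCat.{u} Λ) : ExtVanishes (j + 1) P Y := by
  have : Module.Projective Λ P.obj := hP
  have : Projective P.obj := (IsProjective.iff_projective P.obj).1 this
  exact Ext.subsingleton_of_projective _ _ _

/-- A short exact sequence whose `Ext¹` vanishes splits. -/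
theorem ExtVanishes.exists_section {A B C : FGModuleCat.{u} Λ} {f : A →ₗ[Λ] B} {g : B →ₗ[Λ] C}
    (hf : Function.Injective f) (hfg : Function.Exact f g) (hg : Function.Surjective g)
    (h : ExtVanishes 1 C A) : ∃ s : C →ₗ[Λ] B, g ∘ₗ s = LinearMap.id := by
  obtain ⟨w, hS⟩ := ShortExactSeq.exists_shortExact f g hf hfg hg
  have : Subsingleton (Ext.{u} C.obj A.obj 1) := h
  -- The obstruction to extending `𝟙 A` along `f` lies in `Ext¹(C, A)`; an extension is a retraction
  -- of `f`, which is equivalent to a section of `g`.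
  obtain ⟨y, hy⟩ := Ext.contravariant_sequence_exact₁ hS A.obj (Ext.mk₀ (𝟙 A.obj))
    (add_zero 1) (Subsingleton.elim _ _)
  obtain ⟨r, rfl⟩ := (Ext.mk₀_bijective _ _).2 y
  rw [Ext.mk₀_comp_mk₀] at hy
  have hr := (Ext.mk₀_bijective _ _).1 hy
  have hr' : r.hom ∘ₗ f = LinearMap.id := congrArg ModuleCat.Hom.hom hr
  have hl : ∃ l : B →ₗ[Λ] A, l ∘ₗ f = LinearMap.id := ⟨r.hom, hr'⟩
  exact ((Function.Exact.split_tfae hfg hf hg).out 0 1).2 hl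

/-! ### Direct summands as retracts -/

theorem isSummand_of_retract [IsNoetherianRing Λ] {Z N : FGModuleCat.{u} Λ} (i : Z →ₗ[Λ] N)
    (p : N →ₗ[Λ] Z) (h : p ∘ₗ i = LinearMap.id) : IsSummand Z N := by
  have h' : ∀ z, p (i z) = z := fun z => LinearMap.congr_fun h z
  -- The complement `ker p` is finitely generated because `Λ` is noetherian.
  refine ⟨FGModuleCat.of Λ (LinearMap.ker p), ⟨?_⟩⟩
  exact
    { toFun := fun x => (p x, ⟨x - i (p x), by simp [LinearMap.mem_ker, h']⟩)
      map_add' := fun x y => by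
        refine Prod.ext (map_add p x y) (Subtype.ext ?_)
        change x + y - i (p (x + y)) = (x - i (p x)) + (y - i (p y))
        rw [map_add, map_add]; abel
      map_smul' := fun c x => by
        refine Prod.ext (map_smul p c x) (Subtype.ext ?_)
        change c • x - i (p (c • x)) = c • (x - i (p x))
        rw [map_smul, map_smul, smul_sub]
      invFun := fun w => i w.1 + w.2.1
      left_inv := fun x => by
        change i (p x) + (x - i (p x)) = x
        abel
      right_inv := fun w => by
        have hw : p w.2.1 = 0 := w.2.2
        have hp : p (i w.1 + w.2.1) = w.1 := by rw [map_add, h', hw, add_zero]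
        refine Prod.ext hp (Subtype.ext ?_)
        change i w.1 + w.2.1 - i (p (i w.1 + w.2.1)) = w.2.1
        rw [hp]; abel }

theorem IsSummand.exists_retract {Z N : FGModuleCat.{u} Λ} (h : IsSummand Z N) :
    ∃ (i : Z →ₗ[Λ] N) (p : N →ₗ[Λ] Z), p ∘ₗ i = LinearMap.id := by
  obtain ⟨Z', ⟨e⟩⟩ := h
  refine ⟨e.symm.toLinearMap ∘ₗ LinearMap.inl Λ Z Z', LinearMap.fst Λ Z Z' ∘ₗ e.toLinearMap, ?_⟩
  ext z
  simp

theorem IsSummand.trans [IsNoetherianRing Λ] {X Y Z : FGModuleCat.{u} Λ} (h : IsSummand X Y)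
    (h' : IsSummand Y Z) : IsSummand X Z := by
  obtain ⟨i, p, hip⟩ := h.exists_retract
  obtain ⟨j, q, hjq⟩ := h'.exists_retract
  refine isSummand_of_retract (j ∘ₗ i) (p ∘ₗ q) ?_
  rw [LinearMap.comp_assoc, ← LinearMap.comp_assoc i j q, hjq, LinearMap.id_comp, hip]

theorem isSummand_of_equiv [IsNoetherianRing Λ] {X Y : FGModuleCat.{u} Λ} (e : X ≃ₗ[Λ] Y) :
    IsSummand X Y :=
  isSummand_of_retract e.toLinearMap e.symm.toLinearMap (by ext; simp)

theorem IsSummand.mem_projectives {Z N : FGModuleCat.{u} Λ} (h : IsSummand Z N)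
    (hN : N ∈ projectives Λ) : Z ∈ projectives Λ := by
  obtain ⟨i, p, hip⟩ := h.exists_retract
  have : Module.Projective Λ N := hN
  exact Module.Projective.of_split i p hip

theorem mem_projectives_of_subsingleton {M : FGModuleCat.{u} Λ} (h : Subsingleton M) :
    M ∈ projectives Λ := by
  have : Module.Projective Λ M := inferInstance
  exact this

/-! ### Dimension shifting along syzygies -/

variable [IsArtinianRing Λ]

theorem projectiveCover_mem_projectives (M : FGModuleCat.{u} Λ) :
    projectiveCover M ∈ projectives Λ :=
  (isProjectiveCover_projectiveCoverMap M).projective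

theorem shortExactSeq_syzygy (M : FGModuleCat.{u} Λ) :
    ShortExactSeq (syzygy M) (projectiveCover M) M :=
  ⟨(LinearMap.ker (projectiveCoverMap M)).subtype, projectiveCoverMap M,
    Subtype.val_injective, LinearMap.exact_subtype_ker_map _,
    (isProjectiveCover_projectiveCoverMap M).surjective⟩

theorem extVanishes_syzygy_iff (j : ℕ) (M Y : FGModuleCat.{u} Λ) :
    ExtVanishes (j + 1) (syzygy M) Y ↔ ExtVanishes (j + 2) M Y :=
  ⟨fun h => h.right (shortExactSeq_syzygy M)
      (.of_projective (projectiveCover_mem_projectives M) _ _),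
    fun h => .left (shortExactSeq_syzygy M)
      (.of_projective (projectiveCover_mem_projectives M) _ _) h⟩

theorem extVanishes_iterate_syzygy_iff (k j : ℕ) (M Y : FGModuleCat.{u} Λ) :
    ExtVanishes (j + 1) (syzygy^[k] M) Y ↔ ExtVanishes (k + j + 1) M Y := by
  induction k generalizing M with
  | zero => rw [Nat.zero_add]; rfl
  | succ k ih =>
    rw [Function.iterate_succ_apply, ih, extVanishes_syzygy_iff]
    rw [show k + 1 + j + 1 = k + j + 2 by omega]

theorem syzygy_mem_projectives {P : FGModuleCat.{u} Λ} (h : P ∈ projectives Λ) :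
    syzygy P ∈ projectives Λ :=
  mem_projectives_of_subsingleton (subsingleton_syzygy h)

theorem iterate_syzygy_mem_projectives {M : FGModuleCat.{u} Λ} {k m : ℕ} (hkm : k ≤ m)
    (h : syzygy^[k] M ∈ projectives Λ) : syzygy^[m] M ∈ projectives Λ := by
  induction m, hkm using Nat.le_induction with
  | base => exact h
  | succ m _ ih =>
    rw [Function.iterate_succ_apply']
    exact syzygy_mem_projectives ih

theorem mem_projectives_of_subsingleton_syzygy {M : FGModuleCat.{u} Λ}
    (h : Subsingleton (syzygy M)) : M ∈ projectives Λ := by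
  have hc := isProjectiveCover_projectiveCoverMap M
  have h' : Subsingleton (LinearMap.ker (projectiveCoverMap M)) := h
  have hinj : Function.Injective (projectiveCoverMap M) := by
    rw [← LinearMap.ker_eq_bot]
    exact Submodule.subsingleton_iff_eq_bot.1 h'
  have := hc.projective
  exact Module.Projective.of_equiv (LinearEquiv.ofBijective _ ⟨hinj, hc.surjective⟩)

/-- One test module suffices: vanishing against the syzygy splits the projective cover sequence. -/
theorem mem_projectives_of_extVanishes {M : FGModuleCat.{u} Λ}
    (h : ExtVanishes 1 M (syzygy M)) : M ∈ projectives Λ := by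
  obtain ⟨f, g, hf, hfg, hg⟩ := shortExactSeq_syzygy M
  obtain ⟨s, hs⟩ := h.exists_section hf hfg hg
  have := (isProjectiveCover_projectiveCoverMap M).projective
  exact Module.Projective.of_split s g hs

/-- Dimension shifting turns `Ext^(n+1)(M, -) = 0` into `Ext¹(Ω^n M, -) = 0`, which makes `Ω^n M`
projective. This converts the `Ext` definition into the form that can be compared with `Φ`. -/
theorem projDim_le_iff (M : FGModuleCat.{u} Λ) (k : ℕ) :
    projDim M ≤ k ↔ syzygy^[k] M ∈ projectives Λ := by
  constructor
  · intro h
    -- A strict inequality against an infimum yields an actual index `n`, hence the detour through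
    -- `k + 1`.
    have hlt : projDim M < (k + 1 : ℕ) := h.trans_lt (by exact_mod_cast k.lt_succ_self)
    simp only [projDim, iInf_lt_iff] at hlt
    obtain ⟨n, hn, hnk⟩ := hlt
    have hnk' : n ≤ k := Nat.lt_succ_iff.1 (by exact_mod_cast hnk)
    refine iterate_syzygy_mem_projectives hnk' (mem_projectives_of_extVanishes ?_)
    exact (extVanishes_iterate_syzygy_iff n 0 M _).2 (hn _ (by omega) _)
  · intro h
    refine iInf₂_le k fun j hj N => ?_
    obtain ⟨i, rfl⟩ := Nat.exists_eq_add_of_lt hj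
    exact (extVanishes_iterate_syzygy_iff k i M N).1 (.of_projective h _ _)

theorem exists_iterate_syzygy_mem_projectives {M : FGModuleCat.{u} Λ} (h : projDim M < ⊤) :
    ∃ k : ℕ, projDim M = k ∧ syzygy^[k] M ∈ projectives Λ := by
  obtain ⟨k, hk⟩ := ENat.ne_top_iff_exists.1 h.ne
  exact ⟨k, hk.symm, (projDim_le_iff M k).1 hk.symm.le⟩

/-! ### Syzygies of summands and of additive closures -/

theorem IsSummand.syzygy {Z N : FGModuleCat.{u} Λ} (h : IsSummand Z N) :
    IsSummand (syzygy Z) (syzygy N) := by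
  obtain ⟨Z', h⟩ := h
  exact ⟨_, isSum_syzygy h⟩

theorem IsSummand.iterate_syzygy {Z N : FGModuleCat.{u} Λ} (h : IsSummand Z N) (k : ℕ) :
    IsSummand (IgusaTodorov.syzygy^[k] Z) (IgusaTodorov.syzygy^[k] N) := by
  induction k with
  | zero => exact h
  | succ k ih =>
    rw [Function.iterate_succ_apply', Function.iterate_succ_apply']
    exact ih.syzygy

theorem nonempty_syzygy_pi_equiv (M : FGModuleCat.{u} Λ) (s : ℕ) :
    Nonempty (syzygy (FGModuleCat.of Λ (Fin s → M)) ≃ₗ[Λ] (Fin s → syzygy M)) := by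
  induction s with
  | zero =>
    have h0 : Subsingleton (FGModuleCat.of Λ (Fin 0 → M)) :=
      inferInstanceAs (Subsingleton (Fin 0 → M))
    have := subsingleton_syzygy (mem_projectives_of_subsingleton h0)
    exact ⟨0, 0, fun _ => Subsingleton.elim _ _, fun _ => Subsingleton.elim _ _⟩
  | succ s ih =>
    obtain ⟨e⟩ := ih
    obtain ⟨E⟩ := isSum_syzygy (M := FGModuleCat.of Λ (Fin (s + 1) → M)) (X := M)
      (Y := FGModuleCat.of Λ (Fin s → M)) ⟨(Fin.consLinearEquiv Λ fun _ => M).symm⟩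
    exact ⟨E.trans (((LinearEquiv.refl Λ _).prodCongr e).trans
      (Fin.consLinearEquiv Λ fun _ => syzygy M))⟩

theorem syzygy_mem_addClosure {Z M : FGModuleCat.{u} Λ} (h : Z ∈ addClosure M) :
    syzygy Z ∈ addClosure (syzygy M) := by
  obtain ⟨s, hs⟩ := h
  obtain ⟨e⟩ := nonempty_syzygy_pi_equiv M s
  exact ⟨s, hs.syzygy.trans (isSummand_of_equiv e)⟩

theorem mem_addClosure_of_isSummand {Y Z M : FGModuleCat.{u} Λ} (h : IsSummand Y Z)
    (hZ : Z ∈ addClosure M) : Y ∈ addClosure M := by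
  obtain ⟨s, hs⟩ := hZ
  exact ⟨s, h.trans hs⟩

theorem mem_addClosure_self (M : FGModuleCat.{u} Λ) : M ∈ addClosure M :=
  ⟨1, isSummand_of_equiv (Y := FGModuleCat.of Λ (Fin 1 → M))
    (LinearEquiv.funUnique (Fin 1) Λ M).symm⟩

end

section

variable {Λ : Type u} [Ring Λ]

/-! ### Left classes of cotorsion pairs -/

theorem IsCotorsionPair.mem_left_iff {𝒳 𝒴 : Set (FGModuleCat.{u} Λ)} (h : IsCotorsionPair 𝒳 𝒴)
    (M : FGModuleCat.{u} Λ) : M ∈ 𝒳 ↔ ∀ Y ∈ 𝒴, ExtVanishes 1 M Y :=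
  Set.ext_iff.1 h.left_eq M

theorem IsCotorsionPair.mem_of_isSummand {𝒳 𝒴 : Set (FGModuleCat.{u} Λ)}
    (h : IsCotorsionPair 𝒳 𝒴) {Z N : FGModuleCat.{u} Λ} (hZ : IsSummand Z N) (hN : N ∈ 𝒳) : Z ∈ 𝒳 := by
  obtain ⟨i, p, hip⟩ := hZ.exists_retract
  exact (h.mem_left_iff Z).2 fun Y hY => .of_retract i p hip ((h.mem_left_iff N).1 hN Y hY)

/-! ### The group `K` and its quotient by the projectives -/

theorem K.mk_eq_add {M X Y : FGModuleCat.{u} Λ} (h : IsSum M X Y) :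
    K.mk M = K.mk X + K.mk Y := by
  have hr : (FreeAbelianGroup.of M - FreeAbelianGroup.of X - FreeAbelianGroup.of Y) ∈
      splitRelations Λ := AddSubgroup.subset_closure ⟨M, X, Y, h, rfl⟩
  have h0 := (QuotientAddGroup.eq_zero_iff _).2 hr
  rw [QuotientAddGroup.mk_sub, QuotientAddGroup.mk_sub] at h0
  rw [sub_sub, sub_eq_zero] at h0
  exact h0

variable [IsArtinianRing Λ]

/-- A nonzero decomposable finitely generated module is a sum of two modules of smaller length. -/
theorem exists_isSum_length_lt {M : FGModuleCat.{u} Λ} (h0 : ¬ Subsingleton M)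
    (h : ¬ Indecomposable M.obj) :
    ∃ X Y : FGModuleCat.{u} Λ, IsSum M X Y ∧ Module.length Λ X < Module.length Λ M ∧
      Module.length Λ Y < Module.length Λ M := by
  have hM : ¬ Limits.IsZero M.obj := fun hz => h0 (ModuleCat.subsingleton_of_isZero hz)
  simp only [Indecomposable, not_and, not_forall, not_or] at h
  obtain ⟨Y, Z, e, hY, hZ⟩ := h hM
  let E : M ≃ₗ[Λ] Y × Z := (e ≪≫ ModuleCat.biprodIsoProd Y Z).toLinearEquiv
  have : Module.Finite Λ Y := Module.Finite.of_surjective (LinearMap.fst Λ Y Z ∘ₗ E.toLinearMap)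
    (Prod.fst_surjective.comp E.surjective)
  have : Module.Finite Λ Z := Module.Finite.of_surjective (LinearMap.snd Λ Y Z ∘ₗ E.toLinearMap)
    (Prod.snd_surjective.comp E.surjective)
  have : Nontrivial Y := not_subsingleton_iff_nontrivial.1 fun hs =>
    hY (ModuleCat.isZero_of_subsingleton Y)
  have : Nontrivial Z := not_subsingleton_iff_nontrivial.1 fun hs =>
    hZ (ModuleCat.isZero_of_subsingleton Z)
  have hl : Module.length Λ M = Module.length Λ Y + Module.length Λ Z := by
    rw [E.length_eq, Module.length_prod]
  refine ⟨FGModuleCat.of Λ Y, FGModuleCat.of Λ Z, ⟨E⟩, ?_, ?_⟩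
  · rw [hl, add_comm]
    exact ENat.lt_add_left (Module.length_ne_top (R := Λ) (M := Y))
      (Module.length_pos (R := Λ) (M := Z))
  · rw [hl]
    exact ENat.lt_add_left (Module.length_ne_top (R := Λ) (M := Z))
      (Module.length_pos (R := Λ) (M := Y))

/-- The bracket is generated by indecomposables only, so `M` is decomposed by induction on length;
the condition on all summands is inherited by both pieces. No uniqueness of the decomposition is
needed. -/
theorem mk_mem_bracket {𝒞 : Set (FGModuleCat.{u} Λ)} (M : FGModuleCat.{u} Λ)
    (h : ∀ Z, IsSummand Z M → Z ∈ 𝒞) : K.mk M ∈ bracket 𝒞 := by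
  induction hl : Module.length Λ M using WellFoundedLT.induction generalizing M with
  | ind l ih =>
    subst hl
    by_cases h0 : Subsingleton M
    · rw [K.mk_eq_zero M h0]
      exact zero_mem _
    by_cases hM : Indecomposable M.obj
    · exact AddSubgroup.subset_closure
        ⟨M, Or.inl (h M (isSummand_of_equiv (LinearEquiv.refl Λ M))), hM, rfl⟩
    obtain ⟨X, Y, ⟨e⟩, hX, hY⟩ := exists_isSum_length_lt h0 hM
    rw [K.mk_eq_add ⟨e⟩]
    exact add_mem
      (ih _ hX X (fun Z hZ => h Z (hZ.trans ⟨Y, ⟨e⟩⟩)) rfl)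
      (ih _ hY Y (fun Z hZ => h Z (hZ.trans ⟨X, ⟨e.trans (LinearEquiv.prodComm Λ X Y)⟩⟩)) rfl)

/-- The class of `M` in `K_𝒫`. -/
def KP.mk (M : FGModuleCat.{u} Λ) : KP Λ :=
  QuotientAddGroup.mk' (bracket (projectives Λ)) (K.mk M)

theorem Lbar_mk (M : FGModuleCat.{u} Λ) : Lbar Λ (KP.mk M) = KP.mk (syzygy M) := by
  change (QuotientAddGroup.mk' _ (L Λ (K.mk M)) : KP Λ) = _
  rw [L_mk]
  rfl

theorem Lbar_iterate_mk (m : ℕ) (M : FGModuleCat.{u} Λ) :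
    (Lbar Λ)^[m] (KP.mk M) = KP.mk (syzygy^[m] M) := by
  induction m with
  | zero => rfl
  | succ m ih => rw [Function.iterate_succ_apply', Function.iterate_succ_apply', ih, Lbar_mk]

/-- The length of the syzygy, as an additive invariant on `K`. -/
noncomputable def syzygyLength (Λ : Type u) [Ring Λ] [IsArtinianRing Λ] : K Λ →+ ℤ :=
  QuotientAddGroup.lift (splitRelations Λ)
    (FreeAbelianGroup.lift fun M => ((Module.length Λ (syzygy M)).toNat : ℤ)) (by
    rw [splitRelations, AddSubgroup.closure_le]
    rintro _ ⟨M, X, Y, h, rfl⟩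
    obtain ⟨e⟩ := isSum_syzygy h
    have hl : (Module.length Λ (syzygy M)).toNat =
        (Module.length Λ (syzygy X)).toNat + (Module.length Λ (syzygy Y)).toNat := by
      rw [e.length_eq, Module.length_prod, ENat.toNat_add Module.length_ne_top
        Module.length_ne_top]
    simp [hl])

theorem syzygyLength_mk (M : FGModuleCat.{u} Λ) :
    syzygyLength Λ (K.mk M) = ((Module.length Λ (syzygy M)).toNat : ℤ) := by
  simp [syzygyLength, K.mk]

/-- The length of `ΩM` is additive on `K` and kills `⟨𝒫⟩`, so a zero class forces `ΩM = 0`. This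
invariant replaces an appeal to Krull–Schmidt. -/
theorem KP.mk_eq_zero_iff (M : FGModuleCat.{u} Λ) : KP.mk M = 0 ↔ M ∈ projectives Λ := by
  rw [KP.mk, QuotientAddGroup.mk'_apply, QuotientAddGroup.eq_zero_iff]
  constructor
  · intro h
    have hle : bracket (projectives Λ) ≤ (syzygyLength Λ).ker := by
      rw [bracket, AddSubgroup.closure_le]
      rintro _ ⟨P, hP, -, rfl⟩
      have hP' : P ∈ projectives Λ := by simpa using hP
      have := subsingleton_syzygy hP'
      change syzygyLength Λ (K.mk P) = 0
      rw [syzygyLength_mk, Module.length_eq_zero]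
      rfl
    have h0 : syzygyLength Λ (K.mk M) = 0 := hle h
    rw [syzygyLength_mk, Int.natCast_eq_zero, ENat.toNat_eq_zero] at h0
    exact mem_projectives_of_subsingleton_syzygy
      (Module.length_eq_zero_iff.1 (h0.resolve_right Module.length_ne_top))
  · exact fun h => mk_mem_bracket M fun Z hZ => hZ.mem_projectives h

/-! ### The function `η` -/

section eta

variable {G : Type*} [AddCommGroup G] (f : G →+ G)

/-- Surjectivity onto the next image is automatic; only injectivity matters, and it restricts to
subsets. -/
theorem bijOn_iterate_iff (S : AddSubgroup G) (m : ℕ) :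
    Set.BijOn f (f^[m] '' S) (f^[m + 1] '' S) ↔ Set.InjOn f (f^[m] '' S) := by
  refine ⟨fun h => h.injOn, fun h => ?_⟩
  rw [Function.iterate_succ', Set.image_comp]
  exact h.bijOn_image

theorem eta_mono {S T : AddSubgroup G} (h : S ≤ T) : eta f S ≤ eta f T := by
  refine le_iInf₂ fun k hk => iInf₂_le k fun m hm => ?_
  rw [bijOn_iterate_iff]
  exact ((bijOn_iterate_iff f T m).1 (hk m hm)).mono (Set.image_mono h)

/-- The images of `f(S)` are those of `S` shifted by one level, since `f^(j+1)(S) = f^j(f(S))`. -/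
theorem eta_le_eta_map_add_one (S : AddSubgroup G) : eta f S ≤ eta f (S.map f) + 1 := by
  by_cases htop : eta f (S.map f) = ⊤
  · simp [htop]
  obtain ⟨k, hk⟩ := ENat.ne_top_iff_exists.1 htop
  rw [← hk]
  have hlt : eta f (S.map f) < (k + 1 : ℕ) := by rw [← hk]; exact_mod_cast k.lt_succ_self
  simp only [eta, iInf_lt_iff] at hlt
  obtain ⟨l, hl, hlk⟩ := hlt
  have hlk' : l < k + 1 := by exact_mod_cast hlk
  refine iInf₂_le (k + 1) fun m hm => ?_
  obtain ⟨j, rfl⟩ : ∃ j, m = j + 1 := ⟨m - 1, by omega⟩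
  have := (bijOn_iterate_iff f _ j).1 (hl j (by omega))
  rw [bijOn_iterate_iff, Function.iterate_succ, Set.image_comp]
  exact this

end eta

/-! ### The first Igusa–Todorov function -/

/-- The image of `⟨add M⟩` in `K_𝒫`. -/
def addBracket (M : FGModuleCat.{u} Λ) : AddSubgroup (KP Λ) :=
  (bracket (addClosure M)).map (QuotientAddGroup.mk' (bracket (projectives Λ)))

theorem mk_mem_addBracket {Z M : FGModuleCat.{u} Λ} (h : Z ∈ addClosure M) :
    KP.mk Z ∈ addBracket M :=
  ⟨K.mk Z, mk_mem_bracket Z fun _ hY => mem_addClosure_of_isSummand hY h, rfl⟩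

/-- Generators are of two kinds: `Ω` carries `add M` into `add ΩM`, and projectives go to zero. -/
theorem map_Lbar_addBracket_le (M : FGModuleCat.{u} Λ) :
    (addBracket M).map (Lbar Λ) ≤ addBracket (syzygy M) := by
  rw [AddSubgroup.map_le_iff_le_comap, addBracket, AddSubgroup.map_le_iff_le_comap, bracket,
    AddSubgroup.closure_le]
  rintro _ ⟨Z, hZ, -, rfl⟩
  change Lbar Λ (KP.mk Z) ∈ addBracket (syzygy M)
  rw [Lbar_mk]
  rcases hZ with hZ | hZ
  · exact mk_mem_addBracket (syzygy_mem_addClosure hZ)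
  · rw [(KP.mk_eq_zero_iff _).2 (syzygy_mem_projectives hZ)]
    exact zero_mem _

theorem Phi_le_Phi_syzygy_add_one (M : FGModuleCat.{u} Λ) : Phi M ≤ Phi (syzygy M) + 1 :=
  (eta_le_eta_map_add_one _ _).trans
    (add_le_add_left (eta_mono _ (map_Lbar_addBracket_le M)) 1)

theorem Phi_le_Phi_iterate_syzygy_add (M : FGModuleCat.{u} Λ) (k : ℕ) :
    Phi M ≤ Phi (syzygy^[k] M) + k := by
  induction k generalizing M with
  | zero => simp
  | succ k ih =>
    calc Phi M ≤ Phi (syzygy M) + 1 := Phi_le_Phi_syzygy_add_one M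
      _ ≤ Phi (syzygy^[k] (syzygy M)) + k + 1 := add_le_add_left (ih _) 1
      _ = Phi (syzygy^[k + 1] M) + (k + 1 : ℕ) := by
        rw [Function.iterate_succ_apply, add_assoc]; norm_cast

/-- The class of `Ω^m M` lies in the `m`-th image and is zero for large `m`. From level `k` on,
injectivity of `Lbar` pulls this vanishing back one step at a time, so `Ω^k M` is already
projective. -/
theorem projDim_le_Phi {M : FGModuleCat.{u} Λ} (h : projDim M < ⊤) : projDim M ≤ Phi M := by
  obtain ⟨p, -, hp⟩ := exists_iterate_syzygy_mem_projectives h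
  refine le_iInf₂ fun k hk => (projDim_le_iff M k).2 ?_
  have hM : ∀ m, KP.mk (syzygy^[m] M) ∈ (Lbar Λ)^[m] '' (addBracket M : Set (KP Λ)) := fun m =>
    ⟨KP.mk M, mk_mem_addBracket (mem_addClosure_self M), Lbar_iterate_mk m M⟩
  have h0 : ∀ m, (0 : KP Λ) ∈ (Lbar Λ)^[m] '' (addBracket M : Set (KP Λ)) := fun m =>
    ⟨0, zero_mem _, iterate_map_zero _ m⟩
  have step : ∀ m ≥ k, syzygy^[m + 1] M ∈ projectives Λ → syzygy^[m] M ∈ projectives Λ := by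
    intro m hm h1
    rw [← KP.mk_eq_zero_iff] at h1 ⊢
    refine (hk m hm).injOn (hM m) (h0 m) ?_
    rw [Lbar_mk, map_zero, ← Function.iterate_succ_apply' syzygy m M, h1]
  have hall : ∀ j, syzygy^[k + j] M ∈ projectives Λ → syzygy^[k] M ∈ projectives Λ := by
    intro j
    induction j with
    | zero => exact id
    | succ j ih => exact fun h1 => ih (step (k + j) (Nat.le_add_right k j) h1)
  exact hall p (iterate_syzygy_mem_projectives (Nat.le_add_left p k) hp)

theorem mem_projectives_of_projDim_lt_top {𝒳 : Set (FGModuleCat.{u} Λ)}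
    (h0 : PhiDimClass 𝒳 = 0) {Z : FGModuleCat.{u} Λ} (hZ : Z ∈ 𝒳)
    (hfin : projDim Z < ⊤) : Z ∈ projectives Λ := by
  have : projDim Z ≤ (0 : ℕ) := (projDim_le_Phi hfin).trans
    ((le_iSup₂ (f := fun X (_ : X ∈ 𝒳) => Phi X) Z hZ).trans h0.le)
  exact (projDim_le_iff Z 0).1 this

theorem finDim_le_PhiDim (Λ : Type u) [Ring Λ] [IsArtinianRing Λ] : finDim Λ ≤ PhiDim Λ :=
  iSup₂_le fun M _ => iSup_le fun h =>
    (projDim_le_Phi h).trans (le_iSup₂ (f := fun X (_ : X ∈ Set.univ) => Phi X) M trivial)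

theorem PhiDim_le_PsiDim (Λ : Type u) [Ring Λ] [IsArtinianRing Λ] : PhiDim Λ ≤ PsiDim Λ :=
  iSup₂_le fun M _ => le_self_add.trans (le_iSup Psi M)

/-! ### Hereditary complete cotorsion pairs -/

namespace IsHereditaryCompleteCotorsionPair

variable {𝒳 𝒴 : Set (FGModuleCat.{u} Λ)}

theorem syzygy_mem (h : IsHereditaryCompleteCotorsionPair 𝒳 𝒴)
    {M : FGModuleCat.{u} Λ} (hM : M ∈ 𝒳) : syzygy M ∈ 𝒳 :=
  h.resolving.kernel _ _ _ (shortExactSeq_syzygy M)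
    (h.resolving.projective (projectiveCover_mem_projectives M)) hM

theorem iterate_syzygy_mem (h : IsHereditaryCompleteCotorsionPair 𝒳 𝒴)
    {M : FGModuleCat.{u} Λ} {k m : ℕ} (hkm : k ≤ m)
    (hM : syzygy^[k] M ∈ 𝒳) : syzygy^[m] M ∈ 𝒳 := by
  induction m, hkm using Nat.le_induction with
  | base => exact hM
  | succ m _ ih =>
    rw [Function.iterate_succ_apply']
    exact h.syzygy_mem ih

theorem extVanishes (h : IsHereditaryCompleteCotorsionPair 𝒳 𝒴)
    {M Y : FGModuleCat.{u} Λ} (hM : M ∈ 𝒳) (hY : Y ∈ 𝒴) (j : ℕ) :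
    ExtVanishes (j + 1) M Y :=
  (extVanishes_iterate_syzygy_iff j 0 M Y).1
    ((h.mem_left_iff _).1 (h.iterate_syzygy_mem (Nat.zero_le j) hM) Y hY)

theorem extVanishes_of_hasResolution (h : IsHereditaryCompleteCotorsionPair 𝒳 𝒴)
    {r : ℕ} {M Y : FGModuleCat.{u} Λ}
    (hM : HasResolution 𝒳 r M) (hY : Y ∈ 𝒴) (j : ℕ) : ExtVanishes (r + j + 1) M Y := by
  induction r generalizing M with
  | zero =>
    obtain ⟨X, hX, ⟨e⟩⟩ := hM
    exact h.extVanishes (h.mem_of_isSummand (isSummand_of_equiv e.symm) hX) hY _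
  | succ r ih =>
    obtain ⟨X, hX, K, hK, hres⟩ := hM
    have := (ih hres).right hK (h.extVanishes hX hY (r + j + 1))
    rwa [show r + 1 + j + 1 = r + j + 1 + 1 by omega]

theorem iterate_syzygy_mem_of_hasResolution (h : IsHereditaryCompleteCotorsionPair 𝒳 𝒴)
    {r : ℕ} {M : FGModuleCat.{u} Λ}
    (hM : HasResolution 𝒳 r M) : syzygy^[r] M ∈ 𝒳 :=
  (h.mem_left_iff _).2 fun Y hY =>
    (extVanishes_iterate_syzygy_iff r 0 M Y).2 (h.extVanishes_of_hasResolution hM hY 0)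

/-- The approximation `0 → Y → X → N → 0` has its kernel in `ω` and therefore splits, making `N` a
summand of `X`. -/
theorem mem_of_syzygy_mem (h : IsHereditaryCompleteCotorsionPair 𝒳 𝒴)
    {N : FGModuleCat.{u} Λ} (hN : syzygy N ∈ 𝒳)
    (hω : ∀ W ∈ 𝒳 ∩ 𝒴, ExtVanishes 1 N W) : N ∈ 𝒳 := by
  obtain ⟨Y, hY, X, hX, hs⟩ := h.complete_left N
  -- `Ext¹(Y, Y')` sits between `Ext¹(X, Y') = 0` and `Ext²(N, Y')`, and the latter vanishes because
  -- `Ext¹(ΩN, Y')` does.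
  have hYX : Y ∈ 𝒳 := (h.mem_left_iff Y).2 fun Y' hY' =>
    .left hs ((h.mem_left_iff X).1 hX Y' hY')
      ((extVanishes_syzygy_iff 0 N Y').1 ((h.mem_left_iff _).1 hN Y' hY'))
  obtain ⟨f, g, hf, hfg, hg⟩ := hs
  obtain ⟨s, hsec⟩ := (hω Y ⟨hYX, hY⟩).exists_section hf hfg hg
  exact h.mem_of_isSummand (isSummand_of_retract s g hsec) hX

/-- If `id (𝒳 ∩ 𝒴) ≤ d`, the `d`-th syzygy of a module of finite `𝒳`-resolution dimension
lies in `𝒳`. -/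
theorem iterate_syzygy_mem_of_mem_finiteResolution (h : IsHereditaryCompleteCotorsionPair 𝒳 𝒴)
    {d : ℕ} (hd : injDimClass (𝒳 ∩ 𝒴) ≤ d)
    {M : FGModuleCat.{u} Λ} (hM : M ∈ finiteResolution 𝒳) : syzygy^[d] M ∈ 𝒳 := by
  obtain ⟨r, hr⟩ := hM
  have hω : ∀ W ∈ 𝒳 ∩ 𝒴, ∀ j, ExtVanishes (d + j + 1) M W := by
    intro W hW j
    have hle : injDim W ≤ d := (le_iSup₂ (f := fun W (_ : W ∈ 𝒳 ∩ 𝒴) => injDim W) W hW).trans hd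
    have hlt : injDim W < (d + 1 : ℕ) := hle.trans_lt (by exact_mod_cast d.lt_succ_self)
    simp only [injDim, iInf_lt_iff] at hlt
    obtain ⟨i, hi, hid⟩ := hlt
    have hid' : i < d + 1 := by exact_mod_cast hid
    exact hi _ (by omega) M
  -- Descent from level `d + j` to `d`; it is started at `j = r`, where membership holds because `r
  -- ≤ d + r`.
  have step : ∀ j, syzygy^[d + j] M ∈ 𝒳 → syzygy^[d] M ∈ 𝒳 := by
    intro j
    induction j with
    | zero => exact id
    | succ j ih =>
      intro hj
      refine ih (h.mem_of_syzygy_mem ?_ fun W hW => ?_)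
      · rwa [← Function.iterate_succ_apply' syzygy (d + j) M]
      · exact (extVanishes_iterate_syzygy_iff (d + j) 0 M W).2 (hω W hW j)
  exact step r (h.iterate_syzygy_mem (Nat.le_add_left r d)
    (h.iterate_syzygy_mem_of_hasResolution hr))

theorem Phi_le (h : IsHereditaryCompleteCotorsionPair 𝒳 𝒴)
    {n d : ℕ} (hn : ∀ M : FGModuleCat.{u} Λ, syzygy^[n] M ∈ finiteResolution 𝒳)
    (hd : injDimClass (𝒳 ∩ 𝒴) = d) (M : FGModuleCat.{u} Λ) :
    Phi M ≤ injDimClass (𝒳 ∩ 𝒴) + PhiDimClass 𝒳 + n := by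
  have hM := h.iterate_syzygy_mem_of_mem_finiteResolution hd.le (hn M)
  calc Phi M ≤ Phi (syzygy^[n] M) + n := Phi_le_Phi_iterate_syzygy_add M n
    _ ≤ Phi (syzygy^[d] (syzygy^[n] M)) + d + n :=
      add_le_add_left (Phi_le_Phi_iterate_syzygy_add _ d) _
    _ ≤ PhiDimClass 𝒳 + d + n :=
      add_le_add_left (add_le_add_left (le_iSup₂ (f := fun X (_ : X ∈ 𝒳) => Phi X) _ hM) _) _
    _ = _ := by rw [hd, add_comm (PhiDimClass 𝒳)]

theorem PhiDim_le (h : IsHereditaryCompleteCotorsionPair 𝒳 𝒴)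
    {n : ℕ} (hn : ∀ M : FGModuleCat.{u} Λ, syzygy^[n] M ∈ finiteResolution 𝒳) :
    PhiDim Λ ≤ injDimClass (𝒳 ∩ 𝒴) + PhiDimClass 𝒳 + n := by
  by_cases htop : injDimClass (𝒳 ∩ 𝒴) = ⊤
  · simp [htop]
  obtain ⟨d, hd⟩ := ENat.ne_top_iff_exists.1 htop
  exact iSup₂_le fun M _ => h.Phi_le hn hd.symm M

theorem PsiDim_le (h : IsHereditaryCompleteCotorsionPair 𝒳 𝒴)
    {n : ℕ} (hn : ∀ M : FGModuleCat.{u} Λ, syzygy^[n] M ∈ finiteResolution 𝒳)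
    (h0 : PhiDimClass 𝒳 = 0) : PsiDim Λ ≤ injDimClass (𝒳 ∩ 𝒴) + n := by
  by_cases htop : injDimClass (𝒳 ∩ 𝒴) = ⊤
  · simp [htop]
  obtain ⟨d, hd⟩ := ENat.ne_top_iff_exists.1 htop
  refine iSup_le fun M => ?_
  have hle := h.Phi_le hn hd.symm M
  rw [h0, add_zero, ← hd] at hle
  -- `Φ(M)` is finite by the bound just obtained, so the `toNat` in `Psi` returns its true value
  -- `k`.
  obtain ⟨k, hk⟩ := ENat.ne_top_iff_exists.1
    (hle.trans_lt (by exact_mod_cast ENat.natCast_lt_top (d + n))).ne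
  have hkdn : k ≤ d + n := by rw [← hk] at hle; exact_mod_cast hle
  -- The slack `c = d + n - k` is the number of further syzygies that bring `Ω^k M` into `𝒳`.
  obtain ⟨c, hc⟩ := Nat.exists_eq_add_of_le hkdn
  have hX : syzygy^[c] (syzygy^[k] M) ∈ 𝒳 := by
    rw [← Function.iterate_add_apply, show c + k = d + n by omega, Function.iterate_add_apply]
    exact h.iterate_syzygy_mem_of_mem_finiteResolution hd.symm.le (hn M)
  have hfd : finDimClass {Z | IsSummand Z (syzygy^[k] M)} ≤ c := by
    refine iSup₂_le fun Z hZ => iSup_le fun hfin => (projDim_le_iff Z c).2 ?_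
    refine mem_projectives_of_projDim_lt_top h0 (h.mem_of_isSummand (hZ.iterate_syzygy c) hX) ?_
    -- Finite projective dimension passes from `Z` to `Ω^c Z`: `Ω^(p+c) Z` is projective once `Ω^p
    -- Z` is.
    obtain ⟨p, -, hp⟩ := exists_iterate_syzygy_mem_projectives hfin
    refine lt_of_le_of_lt ((projDim_le_iff _ p).2 ?_) (ENat.natCast_lt_top p)
    rw [← Function.iterate_add_apply]
    exact iterate_syzygy_mem_projectives (Nat.le_add_right p c) hp
  calc Psi M = (k : ℕ∞) + finDimClass {Z | IsSummand Z (syzygy^[k] M)} := by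
        rw [Psi, ← hk, ENat.toNat_natCast]
    _ ≤ k + c := by gcongr
    _ = injDimClass (𝒳 ∩ 𝒴) + n := by rw [← hd]; exact_mod_cast hc.symm

end IsHereditaryCompleteCotorsionPair

end

end IgusaTodorov

theorem corollary4 (Λ : Type u) [Ring Λ] [IgusaTodorov.IsArtinAlgebra Λ]
    (𝒳 𝒴 : Set (FGModuleCat.{u} Λ))
    (h : IgusaTodorov.IsHereditaryCompleteCotorsionPair 𝒳 𝒴) (n : ℕ)
    (hn : ∀ M : FGModuleCat.{u} Λ,
      IgusaTodorov.syzygy^[n] M ∈ IgusaTodorov.finiteResolution 𝒳) :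
    (IgusaTodorov.finDim Λ ≤ IgusaTodorov.PhiDim Λ ∧
      IgusaTodorov.PhiDim Λ ≤
        IgusaTodorov.injDimClass (𝒳 ∩ 𝒴) + IgusaTodorov.PhiDimClass 𝒳 + n) ∧
    (IgusaTodorov.PhiDimClass 𝒳 = 0 →
      IgusaTodorov.finDim Λ ≤ IgusaTodorov.PhiDim Λ ∧
        IgusaTodorov.PhiDim Λ ≤ IgusaTodorov.PsiDim Λ ∧
        IgusaTodorov.PsiDim Λ ≤ IgusaTodorov.injDimClass (𝒳 ∩ 𝒴) + n) :=
  ⟨⟨IgusaTodorov.finDim_le_PhiDim Λ, h.PhiDim_le hn⟩, fun h0 =>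
    ⟨IgusaTodorov.finDim_le_PhiDim Λ, IgusaTodorov.PhiDim_le_PsiDim Λ, h.PsiDim_le hn h0⟩⟩
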